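/- Consider two-player games in which Row has $m$ actions and Column has $n$ actions, $m,n\ge 1$. In the random $m\times n$ game, for each action $j$ of Column, Row's payoffs $(r_{1j},\dots,r_{mj})$ form a uniformly random permutation of $1,\dots,m$; for each action $i$ of Row, Column's payoffs $(c_{i1},\dots,c_{in})$ form a uniformly random permutation of $1,\dots,n$; and all these $m+n$ permutations are mutually independent. A game is (pure-strategy strict-)dominance solvable if, when both players repeatedly delete every action that, in the current restricted game, is strictly dominated by another pure action, eventually exactly one action remains for each player. Let $\pi(m,n)$ be the probability that the random $m\times n$ game is dominance solvable. There exist constants $C_1,C_2>0$ such that for all integers $1\le m\le n$, \[ n^{-(m-1)}\le \pi(m,n), \] and for all integers $2\le m\le n$, \[ \pi(m,n)\le C_1\, n^{-C_2 m}. \] Moreover, $\pi(n,n)\le n^{-\left(\frac13-o(1)\right)n}$; that is, there is a sequence $\varepsilon_n\to 0$ such that $\pi(n,n)\le n^{-\left(\frac13-\varepsilon_n\right)n}$ for all $n\ge 1$. -/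

import Mathlib

open Filter Topology

/-- A finite two-player normal-form game with `m` actions for Row and `n` actions for Column:
`R i j` and `C i j` are the payoffs of Row and of Column when Row plays `i` and Column plays `j`. -/
structure BimatrixGame (m n : ℕ) where
  R : Matrix (Fin m) (Fin n) ℝ
  C : Matrix (Fin m) (Fin n) ℝ

namespace BimatrixGame

variable {m n : ℕ}

/-- Row's action `i` is strictly dominated by a pure action in the restricted game in which Row
has the actions in `A` and Column has the actions in `B`. -/
def RowDominated (G : BimatrixGame m n) (A : Set (Fin m)) (B : Set (Fin n)) (i : Fin m) : Prop :=
  ∃ i' ∈ A, ∀ j ∈ B, G.R i j < G.R i' j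

/-- Column's action `j` is strictly dominated by a pure action in the restricted game in which Row
has the actions in `A` and Column has the actions in `B`. -/
def ColDominated (G : BimatrixGame m n) (A : Set (Fin m)) (B : Set (Fin n)) (j : Fin n) : Prop :=
  ∃ j' ∈ B, ∀ i ∈ A, G.C i j < G.C i j'

/-- One round of elimination: both players simultaneously discard all their actions that are
strictly dominated (by a pure action) in the current restricted game. -/
def eliminate (G : BimatrixGame m n) (S : Set (Fin m) × Set (Fin n)) :
    Set (Fin m) × Set (Fin n) :=
  ({i ∈ S.1 | ¬ G.RowDominated S.1 S.2 i}, {j ∈ S.2 | ¬ G.ColDominated S.1 S.2 j})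

/-- The actions of Row and of Column that survive the first `k` rounds of elimination. -/
def survivors (G : BimatrixGame m n) : ℕ → Set (Fin m) × Set (Fin n)
  | 0 => (Set.univ, Set.univ)
  | k + 1 => G.eliminate (survivors G k)

/-- Pure-strategy strict-dominance solvability: the iterated elimination arrives at a single
action for each player. (In such a restricted game no action is dominated, so the procedure
stops there.) -/
def DominanceSolvable (G : BimatrixGame m n) : Prop :=
  ∃ (k : ℕ) (i : Fin m) (j : Fin n), G.survivors k = ({i}, {j})

end BimatrixGame

/-- The ordinal data of an `m × n` game: for each action `j` of Column a ranking of Row's actions,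
and for each action `i` of Row a ranking of Column's actions. -/
abbrev OrdinalGame (m n : ℕ) : Type :=
  (Fin n → Equiv.Perm (Fin m)) × (Fin m → Equiv.Perm (Fin n))

/-- The game whose payoffs are the ranks: `r_{·j}` is a permutation of `1, …, m` and `c_{i·}` is
a permutation of `1, …, n`. -/
def OrdinalGame.toGame {m n : ℕ} (g : OrdinalGame m n) : BimatrixGame m n where
  R := fun i j => ((g.1 j i : ℕ) : ℝ) + 1
  C := fun i j => ((g.2 i j : ℕ) : ℝ) + 1

/-- The law of the random game: uniform on the finite product of permutation groups; that is, all
the rankings `r_{·j}` and `c_{i·}` are uniform and they are mutually independent. -/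
noncomputable def randomGame (m n : ℕ) : PMF (OrdinalGame m n) :=
  PMF.uniformOfFintype (OrdinalGame m n)

/-- `π(m, n)`: the probability that the random `m × n` game is dominance solvable. -/
noncomputable def solvabilityProb (m n : ℕ) : ℝ :=
  ((randomGame m n).toOuterMeasure {g | g.toGame.DominanceSolvable}).toReal

/-! The lower bound comes from one event: some column is best for Column in every row. It has
probability `n * n ^ (-m)`, and the game is then solved in two rounds.

For the upper bound with `m ≥ n ^ (1/3)`, stop at the first round after which some player has lost
at least `s` actions. Before that round both had lost fewer than `s`, so each lost action of that
player is dominated by a surviving one on all but fewer than `s` opposing actions. For `s` fixed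
pairs, one ranking agrees with all of them with probability at most `1 / (s + 1)`. Independence and
a union bound over pairs and exempt rankings give `2 * n ^ (3s) / (s + 1) ^ (m - s)`
(`solvabilityProb_le_of_lt`). Taking `s` about `m / K` settles this range and the diagonal case.

For smaller `m` the union bound is too weak, and the first deleted row is examined instead. Until a
row goes, every column undominated in the full game survives; in particular so do the columns that
are records of a later row's ranking when columns are read from the top of the first row's ranking.
The deleted row loses to another row on all of these, which has probability at most `m ^ 2 * 2 ^
(-#records)`. Independence of record indicators bounds the mean of this quantity
(`solvabilityProb_succ_le`), with `s` about `√n`. -/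

/-! ### Union bound over families of dominated points -/

open Finset in
/-- If the points `g k` are distinct and avoid the points `h l`, then the permutations ranking every
`g k` below `h k` make up a fraction of at most `1 / (s + 1)`, where `s` is the number of pairs. -/
theorem card_perm_forall_lt_le {ι α : Type*} [Fintype ι] [Fintype α] [LinearOrder α]
    (g h : ι → α) (hg : Function.Injective g) (hgh : ∀ k l, g k ≠ h l)
    [DecidablePred fun σ : Equiv.Perm α => ∀ k, σ (g k) < σ (h k)] :
    (Fintype.card ι + 1) * #{σ : Equiv.Perm α | ∀ k, σ (g k) < σ (h k)} ≤
      Fintype.card (Equiv.Perm α) := by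
  classical
  set X : Finset (Equiv.Perm α) := {σ : Equiv.Perm α | ∀ k, σ (g k) < σ (h k)} with hX
  -- The translates of `X` by the identity and by these transpositions are pairwise disjoint, which
  -- yields the factor `s + 1`.
  let t : Option ι → Equiv.Perm α := fun o => o.elim 1 fun k => Equiv.swap (g k) (h k)
  have key : Function.Injective fun p : Option ι × X => (p.2 : Equiv.Perm α) * t p.1 := by
    have aux : ∀ (k : ι) (o : Option ι) (σ τ : Equiv.Perm α), σ ∈ X → τ ∈ X →
        σ * t (some k) = τ * t o → some k = o := by
      intro k o σ τ hσ hτ hst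
      simp only [hX, mem_filter, mem_univ, true_and] at hσ hτ
      have hv : ∀ x, σ (t (some k) x) = τ (t o x) := fun x => congrArg (fun e => e x) hst
      have h1 := hv (g k)
      have h2 := hv (h k)
      simp only [t, Option.elim, Equiv.swap_apply_left, Equiv.swap_apply_right] at h1 h2
      cases o with
      | none =>
        simp only [Equiv.Perm.coe_one, id] at h1 h2
        have := hτ k
        rw [← h1, ← h2] at this
        exact absurd (hσ k) this.not_gt
      | some l =>
        by_contra hne
        have hkl : k ≠ l := fun e => hne (by rw [e])
        have hgk : Equiv.swap (g l) (h l) (g k) = g k :=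
          Equiv.swap_apply_of_ne_of_ne (fun e => hkl (hg e)) (hgh k l)
        simp only [hgk] at h1
        by_cases hh : h k = h l
        · have h3 := hv (g l)
          have hgl : Equiv.swap (g k) (h k) (g l) = g l :=
            Equiv.swap_apply_of_ne_of_ne (fun e => hkl (hg e).symm) (hgh l k)
          simp only [t, Option.elim, hgl, Equiv.swap_apply_left] at h3
          have a := hσ l
          have b := hτ k
          rw [h3, ← hh, h1] at a
          rw [hh] at b a
          exact absurd a b.not_gt
        · have hhk : Equiv.swap (g l) (h l) (h k) = h k :=
            Equiv.swap_apply_of_ne_of_ne (fun e => hgh l k e.symm) hh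
          simp only [hhk] at h2
          have := hτ k
          rw [← h1, ← h2] at this
          exact absurd (hσ k) this.not_gt
    rintro ⟨o, σ, hσ⟩ ⟨o', τ, hτ⟩ hst
    simp only at hst
    have ho : o = o' := by
      cases o with
      | some k => exact aux k o' σ τ hσ hτ hst
      | none =>
        cases o' with
        | none => rfl
        | some l => exact (aux l none τ σ hτ hσ hst.symm).symm
    subst ho
    simpa using hst
  have := Fintype.card_le_of_injective _ key
  simpa [Fintype.card_prod, Fintype.card_option] using this

open Finset in
theorem card_pi_forall_mem_le {ι β : Type*} [Fintype ι] [DecidableEq ι] [Fintype β]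
    (A : Finset ι) (X : Finset β) {K : ℕ} (hK : K * #X ≤ Fintype.card β)
    [DecidablePred fun c : ι → β => ∀ i ∈ A, c i ∈ X] :
    K ^ #A * #{c : ι → β | ∀ i ∈ A, c i ∈ X} ≤ Fintype.card (ι → β) := by
  have h1 : ({c : ι → β | ∀ i ∈ A, c i ∈ X} : Finset (ι → β)) =
      Fintype.piFinset fun i => if i ∈ A then X else univ := by
    ext c
    simp only [mem_filter, mem_univ, true_and, Fintype.mem_piFinset]
    refine forall_congr' fun i => ?_
    split_ifs with hi <;> simp [hi]
  have h2 : K ^ #A = ∏ i : ι, if i ∈ A then K else 1 := by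
    rw [prod_ite_mem, univ_inter, prod_const]
  rw [h1, Fintype.card_piFinset, h2, ← prod_mul_distrib, Fintype.card_fun, ← card_univ (α := ι),
    ← prod_const]
  refine prod_le_prod' fun i _ => ?_
  split_ifs
  · exact hK
  · simp

/-- Outside a set of at most `s` of the rankings `c i`, some `s` distinct points are each ranked
below a companion point, the companions being different from all the `s` points. -/
def HasDominatedFamily {p q : ℕ} (s : ℕ) (c : Fin p → Equiv.Perm (Fin q)) : Prop :=
  ∃ (u : Fin s → Fin p) (g h : Fin s → Fin q), Function.Injective g ∧ (∀ k l, g k ≠ h l) ∧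
    ∀ i, i ∉ Set.range u → ∀ k, c i (g k) < c i (h k)

open Finset Classical in
theorem card_forall_notMem_range_le {p q s : ℕ} (u : Fin s → Fin p) (g h : Fin s → Fin q)
    (hg : Function.Injective g) (hgh : ∀ k l, g k ≠ h l) :
    (s + 1) ^ (p - s) *
      #{c : Fin p → Equiv.Perm (Fin q) | ∀ i, i ∉ Set.range u → ∀ k, c i (g k) < c i (h k)} ≤
      Fintype.card (Fin p → Equiv.Perm (Fin q)) := by
  have h1 := card_perm_forall_lt_le g h hg hgh
  rw [Fintype.card_fin] at h1
  have h2 := card_pi_forall_mem_le (univ \ univ.image u) _ h1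
  refine le_trans (Nat.mul_le_mul (Nat.pow_le_pow_right (Nat.succ_pos s) ?_) ?_) h2
  · rw [card_sdiff_of_subset (subset_univ _), card_univ, Fintype.card_fin]
    have : #(univ.image u) ≤ s := card_image_le.trans (by simp)
    omega
  · refine card_le_card fun c hc => ?_
    rw [mem_filter] at hc ⊢
    refine ⟨mem_univ _, fun i hi => mem_filter.2 ⟨mem_univ _, hc.2 i ?_⟩⟩
    rintro ⟨k, rfl⟩
    exact (Finset.mem_sdiff.1 hi).2 (mem_image_of_mem _ (mem_univ _))

-- There are at most `p ^ s` choices of exempt rankings and `q ^ (2 * s)` choices of pairs; at least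
-- `p - s` independent rankings stay constrained.
open Finset Classical in
theorem card_hasDominatedFamily_le (p q s : ℕ) :
    (s + 1) ^ (p - s) * #{c : Fin p → Equiv.Perm (Fin q) | HasDominatedFamily s c} ≤
      p ^ s * q ^ (2 * s) * Fintype.card (Fin p → Equiv.Perm (Fin q)) := by
  let T := (Fin s → Fin p) × (Fin s → Fin q) × (Fin s → Fin q)
  let good : Finset T := {t | Function.Injective t.2.1 ∧ ∀ k l, t.2.1 k ≠ t.2.2 l}
  let E : T → Finset (Fin p → Equiv.Perm (Fin q)) := fun t =>
    univ.filter fun c => ∀ i, i ∉ Set.range t.1 → ∀ k, c i (t.2.1 k) < c i (t.2.2 k)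
  have hsub : ({c : Fin p → Equiv.Perm (Fin q) | HasDominatedFamily s c} : Finset _) ⊆
      good.biUnion E := by
    intro c hc
    obtain ⟨u, g, h, hg, hgh, hc⟩ := (mem_filter.1 hc).2
    exact mem_biUnion.2 ⟨(u, g, h), mem_filter.2 ⟨mem_univ _, hg, hgh⟩,
      mem_filter.2 ⟨mem_univ _, hc⟩⟩
  have hT : #good ≤ p ^ s * q ^ (2 * s) := by
    refine (card_le_univ _).trans (le_of_eq ?_)
    simp only [T, Fintype.card_prod, Fintype.card_fun, Fintype.card_fin]
    ring
  calc _ ≤ (s + 1) ^ (p - s) * ∑ t ∈ good, #(E t) :=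
        Nat.mul_le_mul_left _ ((card_le_card hsub).trans card_biUnion_le)
    _ = ∑ t ∈ good, (s + 1) ^ (p - s) * #(E t) := mul_sum _ _ _
    _ ≤ ∑ _t ∈ good, Fintype.card (Fin p → Equiv.Perm (Fin q)) := by
      refine sum_le_sum fun t ht => ?_
      have ht := (mem_filter.1 ht).2
      exact card_forall_notMem_range_le t.1 t.2.1 t.2.2 ht.1 ht.2
    _ ≤ _ := by
      rw [sum_const, smul_eq_mul]
      exact Nat.mul_le_mul_right _ hT

/-! ### Iterated elimination and the first round with many deletions -/

namespace BimatrixGame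

variable {m n : ℕ}

/-- The same game with the roles of the players exchanged. -/
def swap (G : BimatrixGame m n) : BimatrixGame n m := ⟨G.C.transpose, G.R.transpose⟩

theorem survivors_swap (G : BimatrixGame m n) (k : ℕ) :
    G.swap.survivors k = (G.survivors k).swap := by
  induction k with
  | zero => rfl
  | succ k ih => rw [survivors, ih]; rfl

theorem survivors_succ_fst_subset (G : BimatrixGame m n) (k : ℕ) :
    (G.survivors (k + 1)).1 ⊆ (G.survivors k).1 := fun _ h => h.1

theorem survivors_antitone_fst (G : BimatrixGame m n) :
    Antitone fun k => (G.survivors k).1 :=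
  antitone_nat_of_succ_le G.survivors_succ_fst_subset

/-- Among the dominators of `j`, one with the largest payoff in a fixed surviving row is
undominated, by transitivity. -/
theorem exists_survivor_dominating_of_mem (G : BimatrixGame m n) {k : ℕ}
    (hA : (G.survivors k).1.Nonempty) {j : Fin n} (hj : j ∈ (G.survivors k).2)
    (hj' : j ∉ (G.survivors (k + 1)).2) :
    ∃ j' ∈ (G.survivors (k + 1)).2, ∀ i ∈ (G.survivors k).1, G.C i j < G.C i j' := by
  obtain ⟨i₀, hi₀⟩ := hA
  have hdom : G.ColDominated (G.survivors k).1 (G.survivors k).2 j := by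
    by_contra h
    exact hj' ⟨hj, h⟩
  obtain ⟨a, ha, hmax⟩ := Set.exists_max_image
    {x | x ∈ (G.survivors k).2 ∧ ∀ i ∈ (G.survivors k).1, G.C i j < G.C i x}
    (fun x => G.C i₀ x) (Set.toFinite _) hdom
  refine ⟨a, ⟨ha.1, ?_⟩, ha.2⟩
  rintro ⟨b, hb, hab⟩
  exact absurd (hmax b ⟨hb, fun i hi => (ha.2 i hi).trans (hab i hi)⟩) (hab i₀ hi₀).not_ge

/-- Domination persists when rows are removed, so successive dominators compose until one survives.
-/
theorem exists_survivor_dominating (G : BimatrixGame m n)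
    (hA : ∀ k, (G.survivors k).1.Nonempty) (k : ℕ) {j : Fin n}
    (hj : j ∉ (G.survivors (k + 1)).2) :
    ∃ j' ∈ (G.survivors (k + 1)).2, ∀ i ∈ (G.survivors k).1, G.C i j < G.C i j' := by
  induction k with
  | zero => exact G.exists_survivor_dominating_of_mem (hA 0) trivial hj
  | succ k ih =>
    by_cases h : j ∈ (G.survivors (k + 1)).2
    · exact G.exists_survivor_dominating_of_mem (hA _) h hj
    · obtain ⟨a, ha, hja⟩ := ih h
      have hja' : ∀ i ∈ (G.survivors (k + 1)).1, G.C i j < G.C i a := fun i hi => hja i hi.1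
      by_cases h' : a ∈ (G.survivors (k + 1 + 1)).2
      · exact ⟨a, h', hja'⟩
      · obtain ⟨b, hb, hab⟩ := G.exists_survivor_dominating_of_mem (hA _) ha h'
        exact ⟨b, hb, fun i hi => (hja' i hi).trans (hab i hi)⟩

theorem DominanceSolvable.swap {G : BimatrixGame m n} (h : G.DominanceSolvable) :
    G.swap.DominanceSolvable := by
  obtain ⟨k, i, j, h⟩ := h
  exact ⟨k, j, i, by rw [survivors_swap, h]; rfl⟩

theorem DominanceSolvable.exists_forall_survivors_eq {G : BimatrixGame m n}
    (h : G.DominanceSolvable) :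
    ∃ (K : ℕ) (i : Fin m) (j : Fin n), ∀ k, K ≤ k → G.survivors k = ({i}, {j}) := by
  obtain ⟨K, i, j, hK⟩ := h
  refine ⟨K, i, j, fun k hk => ?_⟩
  induction k, hk using Nat.le_induction with
  | base => exact hK
  | succ k _ ih =>
    rw [survivors, ih]
    refine Prod.ext ?_ ?_ <;> ext x <;> simp [eliminate, RowDominated, ColDominated]
    · rintro rfl; exact le_rfl
    · rintro rfl; exact le_rfl

theorem DominanceSolvable.nonempty_fst {G : BimatrixGame m n} (h : G.DominanceSolvable) (k : ℕ) :
    (G.survivors k).1.Nonempty := by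
  obtain ⟨K, i, j, hK⟩ := h.exists_forall_survivors_eq
  refine ⟨i, G.survivors_antitone_fst (le_max_left k K) ?_⟩
  simp [hK _ (le_max_right k K)]

theorem DominanceSolvable.nonempty_snd {G : BimatrixGame m n} (h : G.DominanceSolvable) (k : ℕ) :
    (G.survivors k).2.Nonempty := by
  have := h.swap.nonempty_fst k
  rwa [survivors_swap] at this

/-- At least `s` columns are each dominated by a column outside this group on a set of rows that
misses fewer than `s` rows. -/
def ManyColsDominated (G : BimatrixGame m n) (s : ℕ) : Prop :=
  ∃ (A : Set (Fin m)) (B : Set (Fin n)), Aᶜ.ncard < s ∧ s ≤ Bᶜ.ncard ∧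
    ∀ j ∉ B, ∃ j' ∈ B, ∀ i ∈ A, G.C i j < G.C i j'

/-- The first round after which either player has lost `s` actions exists because Row finally loses
`m - 1 ≥ s`. By minimality, the opponent of a player crossing the threshold had lost fewer than `s`
before it. -/
theorem DominanceSolvable.manyColsDominated_or {G : BimatrixGame m n} (h : G.DominanceSolvable)
    {s : ℕ} (hs : 1 ≤ s) (hsm : s < m) :
    G.ManyColsDominated s ∨ G.swap.ManyColsDominated s := by
  classical
  have hex : ∃ k, s ≤ (G.survivors k).1ᶜ.ncard ∨ s ≤ (G.survivors k).2ᶜ.ncard := by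
    obtain ⟨k, i, j, hk⟩ := h
    refine ⟨k, Or.inl ?_⟩
    rw [hk, Set.ncard_compl, Set.ncard_singleton, Nat.card_fin]
    omega
  obtain ⟨k, hk⟩ : ∃ k, Nat.find hex = k + 1 := by
    refine Nat.exists_eq_succ_of_ne_zero fun h0 => ?_
    have := Nat.find_spec hex
    rw [h0] at this
    simp [survivors] at this
    omega
  have h1 := Nat.find_spec hex
  have h2 := Nat.find_min hex (m := k) (by omega)
  rw [hk] at h1
  push Not at h2
  rcases h1 with h1 | h1
  · right
    refine ⟨(G.survivors k).2, (G.survivors (k + 1)).1, h2.2, h1, fun i hi => ?_⟩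
    have := G.swap.exists_survivor_dominating h.swap.nonempty_fst k (j := i)
    rw [survivors_swap, survivors_swap] at this
    exact this hi
  · left
    exact ⟨(G.survivors k).1, (G.survivors (k + 1)).2, h2.1, h1, fun j hj =>
      G.exists_survivor_dominating h.nonempty_fst k hj⟩

end BimatrixGame

/-! ### Transfer to rankings and the first upper bound -/

theorem Finset.exists_subset_range_of_card_le {α : Type*} [Nonempty α] (T : Finset α) {s : ℕ}
    (hT : T.card ≤ s) : ∃ u : Fin s → α, ↑T ⊆ Set.range u := by
  obtain ⟨e⟩ : Nonempty (T ↪ Fin s) := Function.Embedding.nonempty_of_card_le (by simpa using hT)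
  refine ⟨Function.extend e Subtype.val fun _ => Classical.arbitrary α, fun x hx => ?_⟩
  exact ⟨e ⟨x, hx⟩, e.injective.extend_apply _ _ _⟩

theorem hasDominatedFamily_of_sets {p q s : ℕ} (hp : 0 < p) (c : Fin p → Equiv.Perm (Fin q))
    (A : Set (Fin p)) (B : Set (Fin q)) (hA : Aᶜ.ncard < s) (hB : s ≤ Bᶜ.ncard)
    (h : ∀ j ∉ B, ∃ j' ∈ B, ∀ i ∈ A, c i j < c i j') : HasDominatedFamily s c := by
  classical
  have : Nonempty (Fin p) := ⟨⟨0, hp⟩⟩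
  rw [Set.ncard_eq_toFinset_card'] at hA hB
  obtain ⟨u, hu⟩ := (Aᶜ).toFinset.exists_subset_range_of_card_le hA.le
  obtain ⟨e⟩ : Nonempty (Fin s ↪ ↥(Bᶜ).toFinset) :=
    Function.Embedding.nonempty_of_card_le
      (by rwa [Fintype.card_fin, Fintype.card_coe])
  have he : ∀ k, (e k : Fin q) ∉ B := fun k => by simpa using (e k).2
  choose f hfB hf using fun k => h _ (he k)
  refine ⟨u, fun k => e k, f, Subtype.val_injective.comp e.injective,
    fun k l hkl => he k ?_, fun i hi k => hf k i ?_⟩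
  · have hkl : (e k : Fin q) = f l := hkl
    exact hkl ▸ hfB l
  by_contra hiA
  exact hi (hu (by simpa using hiA))

theorem OrdinalGame.hasDominatedFamily_or_of_dominanceSolvable {m n s : ℕ} (hs : 1 ≤ s)
    (hsm : s < m) (hmn : m ≤ n) {g : OrdinalGame m n} (h : g.toGame.DominanceSolvable) :
    HasDominatedFamily s g.2 ∨ HasDominatedFamily s g.1 := by
  refine (h.manyColsDominated_or hs hsm).imp ?_ ?_
  · rintro ⟨A, B, hA, hB, hd⟩
    exact hasDominatedFamily_of_sets (by omega) _ A B hA hB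
      (by simpa [OrdinalGame.toGame] using hd)
  · rintro ⟨A, B, hA, hB, hd⟩
    refine hasDominatedFamily_of_sets (by omega) _ A B hA hB fun j hj => ?_
    obtain ⟨j', hj', hlt⟩ := hd j hj
    refine ⟨j', hj', fun i hi => ?_⟩
    have : ((g.1 i j : ℕ) : ℝ) + 1 < ((g.1 i j' : ℕ) : ℝ) + 1 := hlt i hi
    simpa using this

open Classical in
theorem solvabilityProb_eq_card_div (m n : ℕ) : solvabilityProb m n =
    (Finset.card {g : OrdinalGame m n | g.toGame.DominanceSolvable} : ℝ) /
      Fintype.card (OrdinalGame m n) := by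
  rw [solvabilityProb, randomGame, PMF.toOuterMeasure_uniformOfFintype_apply, ENNReal.toReal_div,
    ENNReal.toReal_natCast, ENNReal.toReal_natCast, Fintype.card_subtype]
  rfl

theorem solvabilityProb_le_one (m n : ℕ) : solvabilityProb m n ≤ 1 := by
  classical
  rw [solvabilityProb_eq_card_div]
  exact div_le_one_of_le₀ (by exact_mod_cast Finset.card_le_univ _) (Nat.cast_nonneg _)

open Finset in
theorem card_filter_fst {α β : Type*} [Fintype α] [Fintype β] (P : α → Prop) [DecidablePred P] :
    #{x : α × β | P x.1} = #{a | P a} * Fintype.card β := by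
  rw [← univ_product_univ, ← card_univ (α := β), ← card_product]
  congr 1
  ext x
  simp

open Finset in
theorem card_filter_snd {α β : Type*} [Fintype α] [Fintype β] (P : β → Prop) [DecidablePred P] :
    #{x : α × β | P x.2} = Fintype.card α * #{b | P b} := by
  rw [← univ_product_univ, ← card_univ (α := α), ← card_product]
  congr 1
  ext x
  simp

open Finset in
theorem solvabilityProb_le_of_lt {m n s : ℕ} (hs : 1 ≤ s) (hsm : s < m) (hmn : m ≤ n) :
    solvabilityProb m n ≤ 2 * (n : ℝ) ^ (3 * s) / ((s : ℝ) + 1) ^ (m - s) := by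
  classical
  have hpow : ∀ p q : ℕ, p ≤ n → q ≤ n → p ^ s * q ^ (2 * s) ≤ n ^ (3 * s) := fun p q hp hq =>
    calc p ^ s * q ^ (2 * s) ≤ n ^ s * n ^ (2 * s) :=
          Nat.mul_le_mul (Nat.pow_le_pow_left hp s) (Nat.pow_le_pow_left hq _)
      _ = n ^ (3 * s) := by rw [← pow_add]; congr 1; ring
  have key : ∀ p q : ℕ, m ≤ p → p ≤ n → q ≤ n →
      (s + 1) ^ (m - s) * #{c : Fin p → Equiv.Perm (Fin q) | HasDominatedFamily s c} ≤
        n ^ (3 * s) * Fintype.card (Fin p → Equiv.Perm (Fin q)) := fun p q hmp hp hq =>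
    calc _ ≤ (s + 1) ^ (p - s) * #{c : Fin p → Equiv.Perm (Fin q) | HasDominatedFamily s c} :=
          Nat.mul_le_mul_right _ (Nat.pow_le_pow_right (Nat.succ_pos s) (by omega))
      _ ≤ _ := by convert card_hasDominatedFamily_le p q s
      _ ≤ _ := Nat.mul_le_mul_right _ (hpow p q hp hq)
  have hsub : ({g : OrdinalGame m n | g.toGame.DominanceSolvable} : Finset _) ⊆
      ({g : OrdinalGame m n | HasDominatedFamily s g.2} : Finset _) ∪
      ({g : OrdinalGame m n | HasDominatedFamily s g.1} : Finset _) := by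
    intro g hg
    have := OrdinalGame.hasDominatedFamily_or_of_dominanceSolvable hs hsm hmn (mem_filter.1 hg).2
    simpa using this
  have hcard := (card_le_card hsub).trans (card_union_le _ _)
  have e1 : #{g : OrdinalGame m n | HasDominatedFamily s g.2} = _ :=
    card_filter_snd (α := Fin n → Equiv.Perm (Fin m)) fun c => HasDominatedFamily s c
  have e2 : #{g : OrdinalGame m n | HasDominatedFamily s g.1} = _ :=
    card_filter_fst (β := Fin m → Equiv.Perm (Fin n)) fun c => HasDominatedFamily s c
  rw [e1, e2] at hcard
  have k1 := key m n le_rfl hmn le_rfl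
  have k2 := key n m hmn le_rfl hmn
  have total : (s + 1) ^ (m - s) * #{g : OrdinalGame m n | g.toGame.DominanceSolvable} ≤
      2 * n ^ (3 * s) * Fintype.card (OrdinalGame m n) := by
    rw [Fintype.card_prod]
    calc _ ≤ _ := Nat.mul_le_mul_left _ hcard
      _ = Fintype.card (Fin n → Equiv.Perm (Fin m)) * ((s + 1) ^ (m - s) *
            #{c : Fin m → Equiv.Perm (Fin n) | HasDominatedFamily s c}) +
          ((s + 1) ^ (m - s) * #{c : Fin n → Equiv.Perm (Fin m) | HasDominatedFamily s c}) *
            Fintype.card (Fin m → Equiv.Perm (Fin n)) := by ring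
      _ ≤ _ := Nat.add_le_add (Nat.mul_le_mul_left _ k1) (Nat.mul_le_mul_right _ k2)
      _ = _ := by ring
  rw [solvabilityProb_eq_card_div, div_le_div_iff₀ (by exact_mod_cast Fintype.card_pos)
    (by positivity), mul_comm]
  exact_mod_cast total

/-! ### Records of a random permutation -/

/-- A permutation of `Fin (n + 1)` is given by its last value and the relative order of the
other ones. -/
noncomputable def lastValueEquiv (n : ℕ) :
    Fin (n + 1) × Equiv.Perm (Fin n) ≃ Equiv.Perm (Fin (n + 1)) :=
  Equiv.ofBijective
    (fun x => ((finSuccEquiv' (Fin.last n)).trans (Equiv.optionCongr x.2)).trans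
      (finSuccEquiv' x.1).symm) <| by
    rw [Fintype.bijective_iff_injective_and_card]
    constructor
    · rintro ⟨v, e⟩ ⟨v', e'⟩ h
      have hv := congrArg (fun σ : Equiv.Perm (Fin (n + 1)) => σ (Fin.last n)) h
      simp only [Equiv.trans_apply, finSuccEquiv'_at, Equiv.optionCongr_apply, Option.map_none,
        finSuccEquiv'_symm_none] at hv
      subst hv
      refine Prod.ext rfl (Equiv.ext fun k => ?_)
      have hk := congrArg (fun σ : Equiv.Perm (Fin (n + 1)) => σ k.castSucc) h
      simpa [finSuccEquiv'_last_apply_castSucc] using hk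
    · simp [Fintype.card_perm, Nat.factorial_succ]

theorem lastValueEquiv_last {n : ℕ} (v : Fin (n + 1)) (e : Equiv.Perm (Fin n)) :
    lastValueEquiv n (v, e) (Fin.last n) = v := by
  simp [lastValueEquiv]

theorem lastValueEquiv_castSucc {n : ℕ} (v : Fin (n + 1)) (e : Equiv.Perm (Fin n)) (k : Fin n) :
    lastValueEquiv n (v, e) k.castSucc = v.succAbove (e k) := by
  simp [lastValueEquiv, finSuccEquiv'_last_apply_castSucc]

/-- The value of `σ` at `k` exceeds all the earlier values. -/
def IsRecord {n : ℕ} (σ : Equiv.Perm (Fin n)) (k : Fin n) : Prop := ∀ j < k, σ j < σ k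

theorem isRecord_lastValueEquiv_castSucc {n : ℕ} (v : Fin (n + 1)) (e : Equiv.Perm (Fin n))
    (k : Fin n) : IsRecord (lastValueEquiv n (v, e)) k.castSucc ↔ IsRecord e k := by
  have hlt : ∀ a b : Fin n, v.succAbove (e a) < v.succAbove (e b) ↔ e a < e b := fun a b =>
    (Fin.strictMono_succAbove v).lt_iff_lt
  constructor
  · intro h j hj
    have := h j.castSucc (by simpa using hj)
    rwa [lastValueEquiv_castSucc, lastValueEquiv_castSucc, hlt] at this
  · intro h j hj
    have hjn : j ≠ Fin.last n := (hj.trans (Fin.castSucc_lt_last k)).ne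
    obtain ⟨j, rfl⟩ := Fin.exists_castSucc_eq.2 hjn
    rw [lastValueEquiv_castSucc, lastValueEquiv_castSucc, hlt]
    exact h j (by simpa using hj)

/-- The last record indicator depends on `v` alone and the earlier ones on `e` alone: this is the
independence of records. -/
theorem isRecord_lastValueEquiv_last {n : ℕ} (v : Fin (n + 1)) (e : Equiv.Perm (Fin n)) :
    IsRecord (lastValueEquiv n (v, e)) (Fin.last n) ↔ v = Fin.last n := by
  constructor
  · intro h
    by_contra hv
    obtain ⟨w, hw⟩ := Fin.exists_succAbove_eq (Ne.symm hv)
    have := h (e.symm w).castSucc (Fin.castSucc_lt_last _)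
    rw [lastValueEquiv_castSucc, lastValueEquiv_last, Equiv.apply_symm_apply, hw] at this
    exact absurd this (Fin.le_last v).not_gt
  · rintro rfl j hj
    obtain ⟨j, rfl⟩ := Fin.exists_castSucc_eq.2 hj.ne
    rw [lastValueEquiv_castSucc, lastValueEquiv_last, Fin.succAbove_last]
    exact Fin.castSucc_lt_last _

-- Position `k` is a record with probability `1 / (k + 1)`, independently, so the mean is the
-- product of `1 - 1 / (2 * (k + 1))` over `k ∉ U`. The worst `U` is an initial segment, and the
-- product telescopes up to a square root.
open Finset Classical in
theorem sum_prod_isRecord_le (U : Finset ℕ) (n : ℕ) :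
    ∑ σ : Equiv.Perm (Fin n), ∏ k : Fin n,
        (if IsRecord σ k ∧ (k : ℕ) ∉ U then (1 / 2 : ℝ) else 1) ≤
      n.factorial * √((#(U.filter (· < n)) + 1) / (n + 1)) := by
  induction n with
  | zero => simp
  | succ n ih =>
    set S := ∑ σ : Equiv.Perm (Fin n), ∏ k : Fin n,
        (if IsRecord σ k ∧ (k : ℕ) ∉ U then (1 / 2 : ℝ) else 1) with hS
    have hrec : ∑ σ : Equiv.Perm (Fin (n + 1)), ∏ k : Fin (n + 1),
        (if IsRecord σ k ∧ (k : ℕ) ∉ U then (1 / 2 : ℝ) else 1) =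
        S * (n + if n ∉ U then (1 / 2 : ℝ) else 1) := by
      rw [← (lastValueEquiv n).sum_comp, Fintype.sum_prod_type_right, hS, sum_mul]
      refine sum_congr rfl fun e _ => ?_
      simp only [Fin.prod_univ_castSucc, isRecord_lastValueEquiv_castSucc,
        isRecord_lastValueEquiv_last, Fin.val_castSucc, Fin.val_last]
      rw [← mul_sum, Fin.sum_univ_castSucc]
      congr 1
      simp [Fin.castSucc_ne_last]
    rw [hrec, Nat.factorial_succ]
    have hw : (0 : ℝ) ≤ n + if n ∉ U then (1 / 2 : ℝ) else 1 := by
      split_ifs <;> positivity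
    refine (mul_le_mul_of_nonneg_right ih hw).trans ?_
    have hun : #(U.filter (· < n)) ≤ n := by
      have : U.filter (· < n) ⊆ range n := fun x hx => mem_range.2 (mem_filter.1 hx).2
      simpa using card_le_card this
    have hun' : (#(U.filter (· < n)) : ℝ) ≤ n := by exact_mod_cast hun
    set u : ℝ := (#(U.filter (· < n)) : ℝ) with hu
    have hu0 : 0 ≤ u := Nat.cast_nonneg _
    have hn0 : (0 : ℝ) ≤ n := Nat.cast_nonneg _
    push_cast
    have hF : (0 : ℝ) < n.factorial := by exact_mod_cast n.factorial_pos
    by_cases hn : n ∈ U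
    · have hc : #(U.filter (· < n + 1)) = #(U.filter (· < n)) + 1 := by
        have : U.filter (· < n + 1) = insert n (U.filter (· < n)) := by
          ext x
          simp only [mem_filter, mem_insert]
          constructor
          · rintro ⟨h1, h2⟩
            rcases Nat.lt_succ_iff_lt_or_eq.1 h2 with h | h
            · exact Or.inr ⟨h1, h⟩
            · exact Or.inl h
          · rintro (rfl | ⟨h1, h2⟩)
            · exact ⟨hn, Nat.lt_succ_self _⟩
            · exact ⟨h1, by omega⟩
        rw [this, card_insert_of_notMem (by simp)]
      have hle : √((u + 1) / (n + 1)) ≤ √((u + 1 + 1) / (n + 1 + 1)) := by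
        apply Real.sqrt_le_sqrt
        rw [div_le_div_iff₀ (by positivity) (by positivity)]
        nlinarith
      simp only [hn, not_true_eq_false, if_false, hc]
      push_cast
      rw [← hu]
      calc _ = (n + 1) * n.factorial * √((u + 1) / (n + 1)) := by ring
        _ ≤ _ := mul_le_mul_of_nonneg_left hle (by positivity)
    · have hc : #(U.filter (· < n + 1)) = #(U.filter (· < n)) := by
        congr 1
        ext x
        simp only [mem_filter]
        refine and_congr_right fun hx => ?_
        have : x ≠ n := fun e => hn (e ▸ hx)
        omega
      simp only [hn, not_false_eq_true, if_true, hc]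
      rw [← hu]
      have hle : (n + 1 / 2) * √((u + 1) / (n + 1)) ≤ (n + 1) * √((u + 1) / (n + 1 + 1)) := by
        have h1 : (n + 1 / 2 : ℝ) * √((u + 1) / (n + 1)) =
            √((n + 1 / 2) ^ 2 * ((u + 1) / (n + 1))) := by
          rw [Real.sqrt_mul (by positivity), Real.sqrt_sq (by positivity)]
        have h2 : (n + 1 : ℝ) * √((u + 1) / (n + 1 + 1)) =
            √((n + 1) ^ 2 * ((u + 1) / (n + 1 + 1))) := by
          rw [Real.sqrt_mul (by positivity), Real.sqrt_sq (by positivity)]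
        rw [h1, h2]
        apply Real.sqrt_le_sqrt
        -- Cleared of denominators: `(n + 1/2)² (n + 2) ≤ (n + 1)³`.
        have h3 : ((n : ℝ) + 1 / 2) ^ 2 / (n + 1) ≤ (n + 1) ^ 2 / (n + 1 + 1) := by
          rw [div_le_div_iff₀ (by positivity) (by positivity)]
          nlinarith
        calc _ = ((n : ℝ) + 1 / 2) ^ 2 / (n + 1) * (u + 1) := by ring
          _ ≤ (n + 1) ^ 2 / (n + 1 + 1) * (u + 1) := mul_le_mul_of_nonneg_right h3 (by positivity)
          _ = _ := by ring
      calc _ = n.factorial * ((n + 1 / 2) * √((u + 1) / (n + 1))) := by ring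
        _ ≤ n.factorial * ((n + 1) * √((u + 1) / (n + 1 + 1))) :=
          mul_le_mul_of_nonneg_left hle hF.le
        _ = _ := by ring

/-! ### Columns kept alive by records -/

open Classical in
/-- The points whose `σ`-rank exceeds that of all points ranked higher by `τ`. -/
noncomputable def recordsAlong {n : ℕ} (τ σ : Equiv.Perm (Fin n)) : Finset (Fin n) :=
  {j | ∀ j', τ j < τ j' → σ j' < σ j}

open Finset Classical in
theorem sum_half_pow_card_union_recordsAlong_le {n : ℕ} (τ : Equiv.Perm (Fin n))
    (U : Finset (Fin n)) :
    ∑ σ : Equiv.Perm (Fin n), (1 / 2 : ℝ) ^ #(U ∪ recordsAlong τ σ) ≤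
      n.factorial * ((1 / 2 : ℝ) ^ #U * √((#U + 1) / (n + 1))) := by
  -- `ρ` lists the points from the top of `τ` downwards, turning records along `τ` into ordinary
  -- records.
  let ρ : Equiv.Perm (Fin n) := Fin.revPerm.trans τ.symm
  let V : Finset ℕ := (U.map ρ.symm.toEmbedding).map Fin.valEmbedding
  have hV : ∀ k : Fin n, (k : ℕ) ∈ V ↔ ρ k ∈ U := by
    intro k
    rw [show (k : ℕ) = Fin.valEmbedding k from rfl, Finset.mem_map']
    exact mem_map_equiv
  have hcard : #(V.filter (· < n)) = #U := by
    rw [filter_true_of_mem, card_map, card_map]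
    intro x hx
    obtain ⟨k, _, rfl⟩ := mem_map.1 hx
    exact k.2
  have hτ : ∀ k, τ (ρ k) = Fin.rev k := fun k => by simp [ρ]
  have hrec : ∀ (σ : Equiv.Perm (Fin n)) (k : Fin n),
      ρ k ∈ recordsAlong τ σ ↔ IsRecord (ρ.trans σ) k := by
    intro σ k
    simp only [recordsAlong, mem_filter, mem_univ, true_and, IsRecord, hτ]
    rw [← ρ.forall_congr_right]
    simp [hτ, Fin.rev_lt_rev]
  have hterm : ∀ σ : Equiv.Perm (Fin n), (1 / 2 : ℝ) ^ #(U ∪ recordsAlong τ σ) =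
      (1 / 2 : ℝ) ^ #U * ∏ k : Fin n,
        (if IsRecord (ρ.trans σ) k ∧ (k : ℕ) ∉ V then (1 / 2 : ℝ) else 1) := by
    intro σ
    rw [← union_sdiff_self_eq_union, card_union_of_disjoint disjoint_sdiff, pow_add]
    congr 1
    rw [← prod_const, ← prod_ite_mem_eq, ← Equiv.prod_comp ρ]
    refine prod_congr rfl fun k _ => ?_
    simp only [Finset.mem_sdiff, hrec, hV]
  simp only [hterm]
  rw [← mul_sum]
  have := sum_prod_isRecord_le V n
  rw [hcard] at this
  have hsum : ∑ σ : Equiv.Perm (Fin n), ∏ k : Fin n,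
      (if IsRecord (ρ.trans σ) k ∧ (k : ℕ) ∉ V then (1 / 2 : ℝ) else 1) =
      ∑ σ : Equiv.Perm (Fin n), ∏ k : Fin n,
        (if IsRecord σ k ∧ (k : ℕ) ∉ V then (1 / 2 : ℝ) else 1) :=
    Equiv.sum_comp (Equiv.mulRight ρ) fun σ : Equiv.Perm (Fin n) => ∏ k : Fin n,
      (if IsRecord σ k ∧ (k : ℕ) ∉ V then (1 / 2 : ℝ) else 1)
  rw [hsum]
  calc _ ≤ _ := mul_le_mul_of_nonneg_left this (by positivity)
    _ = _ := by ring

-- Rankings are revealed one at a time. While the union has fewer than `s` points, each costs a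
-- factor at most `√((s + 1) / (n + 1))`; once it has `s` points, the term is at most `2 ^ (-s)`.
open Finset Classical in
theorem sum_half_pow_card_union_biUnion_recordsAlong_le {n : ℕ} (τ : Equiv.Perm (Fin n)) (s p : ℕ)
    (U : Finset (Fin n)) :
    ∑ c : Fin p → Equiv.Perm (Fin n),
        (1 / 2 : ℝ) ^ #(U ∪ univ.biUnion fun i => recordsAlong τ (c i)) ≤
      (n.factorial : ℝ) ^ p *
        ((1 / 2 : ℝ) ^ #U * √((s + 1) / (n + 1)) ^ p + (1 / 2 : ℝ) ^ s) := by
  induction p generalizing U with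
  | zero => simp
  | succ p ih =>
    by_cases hU : s ≤ #U
    · calc _ ≤ ∑ _c : Fin (p + 1) → Equiv.Perm (Fin n), (1 / 2 : ℝ) ^ s :=
            sum_le_sum fun c _ => pow_le_pow_of_le_one (by norm_num) (by norm_num)
              (hU.trans (card_le_card subset_union_left))
        _ = (n.factorial : ℝ) ^ (p + 1) * (1 / 2 : ℝ) ^ s := by
          simp [Fintype.card_perm]
        _ ≤ _ := mul_le_mul_of_nonneg_left (le_add_of_nonneg_left (by positivity)) (by positivity)
    · have hsplit : ∀ (σ : Equiv.Perm (Fin n)) (c : Fin p → Equiv.Perm (Fin n)),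
          (U ∪ univ.biUnion fun i : Fin (p + 1) =>
            recordsAlong τ ((Fin.cons σ c : Fin (p + 1) → Equiv.Perm (Fin n)) i)) =
          (U ∪ recordsAlong τ σ) ∪ univ.biUnion fun i => recordsAlong τ (c i) := by
        intro σ c
        ext x
        simp [Fin.exists_fin_succ]
      have hs : (#U : ℝ) ≤ s := by exact_mod_cast (not_le.1 hU).le
      have hone := sum_half_pow_card_union_recordsAlong_le τ U
      have hmono : √(((#U : ℝ) + 1) / (n + 1)) ≤ √((s + 1) / (n + 1)) :=
        Real.sqrt_le_sqrt (by gcongr)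
      set κ := √(((s : ℝ) + 1) / (n + 1)) with hκ
      have hκ0 : 0 ≤ κ := Real.sqrt_nonneg _
      rw [← (Fin.consEquiv fun _ => Equiv.Perm (Fin n)).sum_comp, Fintype.sum_prod_type]
      calc _ = ∑ σ : Equiv.Perm (Fin n), ∑ c : Fin p → Equiv.Perm (Fin n), (1 / 2 : ℝ) ^
              #((U ∪ recordsAlong τ σ) ∪ univ.biUnion fun i => recordsAlong τ (c i)) :=
            sum_congr rfl fun σ _ => sum_congr rfl fun c _ => by rw [← hsplit]; rfl
        _ ≤ ∑ σ : Equiv.Perm (Fin n), (n.factorial : ℝ) ^ p *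
              ((1 / 2 : ℝ) ^ #(U ∪ recordsAlong τ σ) * κ ^ p + (1 / 2 : ℝ) ^ s) :=
            sum_le_sum fun σ _ => ih _
        _ = (n.factorial : ℝ) ^ p * ((∑ σ : Equiv.Perm (Fin n),
              (1 / 2 : ℝ) ^ #(U ∪ recordsAlong τ σ)) * κ ^ p + n.factorial * (1 / 2 : ℝ) ^ s) := by
            rw [← mul_sum, sum_add_distrib, sum_mul]
            simp [Fintype.card_perm]
        _ ≤ (n.factorial : ℝ) ^ p * ((n.factorial * ((1 / 2 : ℝ) ^ #U * κ)) * κ ^ p +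
              n.factorial * (1 / 2 : ℝ) ^ s) := by
            have : ∑ σ : Equiv.Perm (Fin n), (1 / 2 : ℝ) ^ #(U ∪ recordsAlong τ σ) ≤
                n.factorial * ((1 / 2 : ℝ) ^ #U * κ) := hone.trans (by gcongr)
            gcongr
        _ = _ := by ring

open Classical in
/-- The columns that are records of some later ranking along the first one. -/
noncomputable def recordColumns {p n : ℕ} (c : Fin (p + 1) → Equiv.Perm (Fin n)) :
    Finset (Fin n) :=
  Finset.univ.biUnion fun i : Fin p => recordsAlong (c 0) (c i.succ)

open Finset Classical in
theorem sum_half_pow_card_recordColumns_le (n s p : ℕ) :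
    ∑ c : Fin (p + 1) → Equiv.Perm (Fin n), (1 / 2 : ℝ) ^ #(recordColumns c) ≤
      (n.factorial : ℝ) ^ (p + 1) * (√((s + 1) / (n + 1)) ^ p + (1 / 2 : ℝ) ^ s) := by
  rw [← (Fin.consEquiv fun _ => Equiv.Perm (Fin n)).sum_comp, Fintype.sum_prod_type]
  calc _ ≤ ∑ _τ : Equiv.Perm (Fin n), (n.factorial : ℝ) ^ p *
          (√((s + 1) / (n + 1)) ^ p + (1 / 2 : ℝ) ^ s) := by
        refine sum_le_sum fun τ _ => ?_
        have := sum_half_pow_card_union_biUnion_recordsAlong_le τ s p ∅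
        simpa [recordColumns, Fin.consEquiv] using this
    _ = _ := by simp [Fintype.card_perm]; ring

/-! ### The first deleted row and the second upper bound -/

open Finset Classical in
theorem card_exists_row_dominated_le {m n : ℕ} (V : Finset (Fin n)) :
    (#{r : Fin n → Equiv.Perm (Fin m) | ∃ i i', i ≠ i' ∧ ∀ j ∈ V, r j i < r j i'} : ℝ) ≤
      m ^ 2 * (1 / 2 : ℝ) ^ #V * Fintype.card (Fin n → Equiv.Perm (Fin m)) := by
  have hpair : ∀ i i' : Fin m, i ≠ i' →
      (#{r : Fin n → Equiv.Perm (Fin m) | ∀ j ∈ V, r j i < r j i'} : ℝ) ≤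
        (1 / 2 : ℝ) ^ #V * Fintype.card (Fin n → Equiv.Perm (Fin m)) := by
    intro i i' hii
    have h1 := card_perm_forall_lt_le (ι := Unit) (fun _ => i) (fun _ => i')
      (fun _ _ _ => rfl) fun _ _ => hii
    have h2 := card_pi_forall_mem_le V _ h1
    simp only [Fintype.card_unit, forall_const, mem_filter, mem_univ, true_and] at h2
    have h3 : (2 : ℝ) ^ #V * #{r : Fin n → Equiv.Perm (Fin m) | ∀ j ∈ V, r j i < r j i'} ≤
        Fintype.card (Fin n → Equiv.Perm (Fin m)) := by
      have : 2 ^ #V * #{r : Fin n → Equiv.Perm (Fin m) | ∀ j ∈ V, r j i < r j i'} ≤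
        Fintype.card (Fin n → Equiv.Perm (Fin m)) := by convert h2
      exact_mod_cast this
    rw [one_div, inv_pow, inv_mul_eq_div, le_div_iff₀ (by positivity), mul_comm]
    exact h3
  have hsub : ({r : Fin n → Equiv.Perm (Fin m) | ∃ i i', i ≠ i' ∧ ∀ j ∈ V, r j i < r j i'} :
      Finset _) ⊆ (univ.filter fun x : Fin m × Fin m => x.1 ≠ x.2).biUnion
        fun x => univ.filter fun r => ∀ j ∈ V, r j x.1 < r j x.2 := by
    intro r hr
    obtain ⟨i, i', hii, hr⟩ := (mem_filter.1 hr).2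
    exact mem_biUnion.2 ⟨(i, i'), mem_filter.2 ⟨mem_univ _, hii⟩, mem_filter.2 ⟨mem_univ _, hr⟩⟩
  set N := Fintype.card (Fin n → Equiv.Perm (Fin m))
  calc _ ≤ ((∑ x ∈ univ.filter fun x : Fin m × Fin m => x.1 ≠ x.2,
          #{r : Fin n → Equiv.Perm (Fin m) | ∀ j ∈ V, r j x.1 < r j x.2} : ℕ) : ℝ) := by
        exact_mod_cast (card_le_card hsub).trans card_biUnion_le
    _ ≤ ∑ _x ∈ univ.filter fun x : Fin m × Fin m => x.1 ≠ x.2, (1 / 2 : ℝ) ^ #V * N := by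
        push_cast
        exact sum_le_sum fun x hx => hpair _ _ (mem_filter.1 hx).2
    _ ≤ (m : ℝ) ^ 2 * ((1 / 2 : ℝ) ^ #V * N) := by
        rw [sum_const, nsmul_eq_mul]
        refine mul_le_mul_of_nonneg_right ?_ (by positivity)
        have : #(univ.filter fun x : Fin m × Fin m => x.1 ≠ x.2) ≤ m ^ 2 :=
          (card_le_univ _).trans (by simp [sq])
        exact_mod_cast this
    _ = _ := by ring

/-- A column dominating a record column on all rows would beat it in row `0`, hence lose to it in
the row where it is a record. So record columns are all present when the first row is deleted. -/
theorem OrdinalGame.exists_row_dominated_of_dominanceSolvable {p n : ℕ} (hp : 1 ≤ p)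
    {g : OrdinalGame (p + 1) n} (h : g.toGame.DominanceSolvable) :
    ∃ i i', i ≠ i' ∧ ∀ j ∈ recordColumns g.2, g.1 j i < g.1 j i' := by
  classical
  have hex : ∃ k, (g.toGame.survivors k).1 ≠ Set.univ := by
    obtain ⟨k, i, j, hk⟩ := h
    refine ⟨k, fun hu => ?_⟩
    rw [hk] at hu
    have := congrArg Set.ncard hu
    rw [Set.ncard_singleton, Set.ncard_univ, Nat.card_fin] at this
    omega
  obtain ⟨k, hk⟩ : ∃ k, Nat.find hex = k + 1 :=
    Nat.exists_eq_succ_of_ne_zero fun h0 => by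
      have := Nat.find_spec hex
      rw [h0] at this
      exact this rfl
  have hfull : ∀ l ≤ k, (g.toGame.survivors l).1 = Set.univ := fun l hl => by
    by_contra hne
    have := Nat.find_min' hex hne
    omega
  have hrec : ∀ l ≤ k, ∀ j ∈ recordColumns g.2, j ∈ (g.toGame.survivors l).2 := by
    intro l
    induction l with
    | zero => exact fun _ _ _ => trivial
    | succ l ih =>
      intro hl j hj
      refine ⟨ih (by omega) j hj, ?_⟩
      rintro ⟨j', -, hlt⟩
      rw [hfull l (by omega)] at hlt
      have hlt' : ∀ i, g.2 i j < g.2 i j' := fun i => by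
        have : ((g.2 i j : ℕ) : ℝ) + 1 < ((g.2 i j' : ℕ) : ℝ) + 1 := hlt i trivial
        simpa using this
      obtain ⟨i, -, hi⟩ := Finset.mem_biUnion.1 hj
      exact absurd ((Finset.mem_filter.1 hi).2 j' (hlt' 0)) (hlt' i.succ).not_gt
  have hspec := Nat.find_spec hex
  rw [hk] at hspec
  obtain ⟨i, hi⟩ := (Set.ne_univ_iff_exists_notMem _).1 hspec
  have hdom : g.toGame.RowDominated (g.toGame.survivors k).1 (g.toGame.survivors k).2 i := by
    by_contra hnd
    exact hi ⟨by rw [hfull k le_rfl]; trivial, hnd⟩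
  obtain ⟨i', -, hlt⟩ := hdom
  refine ⟨i, i', ?_, fun j hj => ?_⟩
  · rintro rfl
    obtain ⟨j, hj⟩ := h.nonempty_snd k
    exact lt_irrefl _ (hlt j hj)
  · have : ((g.1 j i : ℕ) : ℝ) + 1 < ((g.1 j i' : ℕ) : ℝ) + 1 := hlt j (hrec k le_rfl j hj)
    simpa using this

open Finset in
theorem solvabilityProb_succ_le {p : ℕ} (hp : 1 ≤ p) (n s : ℕ) :
    solvabilityProb (p + 1) n ≤
      ((p + 1 : ℕ) : ℝ) ^ 2 * (√((s + 1) / (n + 1)) ^ p + (1 / 2 : ℝ) ^ s) := by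
  classical
  set N := Fintype.card (Fin n → Equiv.Perm (Fin (p + 1))) with hN
  have hsub : ({g : OrdinalGame (p + 1) n | g.toGame.DominanceSolvable} : Finset _) ⊆
      univ.biUnion fun c : Fin (p + 1) → Equiv.Perm (Fin n) =>
        ({r : Fin n → Equiv.Perm (Fin (p + 1)) |
          ∃ i i', i ≠ i' ∧ ∀ j ∈ recordColumns c, r j i < r j i'} : Finset _).image
          fun r => (r, c) := by
    intro g hg
    have := OrdinalGame.exists_row_dominated_of_dominanceSolvable hp (mem_filter.1 hg).2
    exact mem_biUnion.2 ⟨g.2, mem_univ _, mem_image.2 ⟨g.1, mem_filter.2 ⟨mem_univ _, this⟩, rfl⟩⟩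
  have hcard : (#{g : OrdinalGame (p + 1) n | g.toGame.DominanceSolvable} : ℝ) ≤
      ((p + 1 : ℕ) : ℝ) ^ 2 * (√((s + 1) / (n + 1)) ^ p + (1 / 2 : ℝ) ^ s) *
        Fintype.card (OrdinalGame (p + 1) n) := by
    calc _ ≤ ((∑ c : Fin (p + 1) → Equiv.Perm (Fin n),
            #{r : Fin n → Equiv.Perm (Fin (p + 1)) |
              ∃ i i', i ≠ i' ∧ ∀ j ∈ recordColumns c, r j i < r j i'} : ℕ) : ℝ) := by
          exact_mod_cast (card_le_card hsub).trans
            (card_biUnion_le.trans (sum_le_sum fun c _ => card_image_le))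
      _ ≤ ∑ c : Fin (p + 1) → Equiv.Perm (Fin n),
            ((p + 1 : ℕ) : ℝ) ^ 2 * (1 / 2 : ℝ) ^ #(recordColumns c) * N := by
          push_cast
          refine sum_le_sum fun c _ => ?_
          convert card_exists_row_dominated_le (m := p + 1) (recordColumns c) <;> push_cast <;> rfl
      _ = ((p + 1 : ℕ) : ℝ) ^ 2 * N *
            ∑ c : Fin (p + 1) → Equiv.Perm (Fin n), (1 / 2 : ℝ) ^ #(recordColumns c) := by
          rw [mul_sum]
          exact sum_congr rfl fun c _ => by ring
      _ ≤ ((p + 1 : ℕ) : ℝ) ^ 2 * N * ((n.factorial : ℝ) ^ (p + 1) *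
            (√((s + 1) / (n + 1)) ^ p + (1 / 2 : ℝ) ^ s)) :=
          mul_le_mul_of_nonneg_left (sum_half_pow_card_recordColumns_le n s p) (by positivity)
      _ = _ := by
          rw [Fintype.card_prod, ← hN, Fintype.card_fun, Fintype.card_perm, Fintype.card_fin,
            Fintype.card_fin]
          push_cast
          ring
  rw [solvabilityProb_eq_card_div]
  refine div_le_of_le_mul₀ (by positivity) (by positivity) ?_
  convert hcard

/-! ### The lower bound -/

theorem OrdinalGame.dominanceSolvable_of_dominant_column {m n : ℕ}
    (g : OrdinalGame (m + 1) (n + 1)) {v : Fin (n + 1)} (hv : ∀ i, g.2 i v = Fin.last n) :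
    g.toGame.DominanceSolvable := by
  set i₀ : Fin (m + 1) := (g.1 v).symm (Fin.last m) with hi₀
  have hC : ∀ i j, j ≠ v → g.toGame.C i j < g.toGame.C i v := by
    intro i j hj
    have : g.2 i j < g.2 i v := by
      rw [hv i]
      exact lt_of_le_of_ne (Fin.le_last _) fun h => hj ((g.2 i).injective (h.trans (hv i).symm))
    simpa [OrdinalGame.toGame] using this
  have hR : ∀ i, i ≠ i₀ → g.toGame.R i v < g.toGame.R i₀ v := by
    intro i hi
    have : g.1 v i < g.1 v i₀ := by
      rw [hi₀, Equiv.apply_symm_apply]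
      exact lt_of_le_of_ne (Fin.le_last _) fun h => hi (by rw [hi₀, ← h, Equiv.symm_apply_apply])
    simpa [OrdinalGame.toGame] using this
  have hv' : ∀ A B, A.Nonempty → ¬ g.toGame.ColDominated A B v := by
    rintro A B ⟨i, hi⟩ ⟨j, -, hlt⟩
    by_cases h : j = v
    · exact lt_irrefl _ (h ▸ hlt i hi)
    · exact (hC i j h).not_gt (hlt i hi)
  have hi' : ∀ A B, v ∈ B → ¬ g.toGame.RowDominated A B i₀ := by
    rintro A B hB ⟨i, -, hlt⟩
    by_cases h : i = i₀
    · exact lt_irrefl _ (h ▸ hlt v hB)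
    · exact (hR i h).not_gt (hlt v hB)
  have h1 : (g.toGame.survivors 1).2 = {v} := by
    ext j
    constructor
    · rintro ⟨-, h⟩
      by_contra hj
      exact h ⟨v, trivial, fun i _ => hC i j hj⟩
    · rintro rfl
      exact ⟨trivial, hv' _ _ ⟨i₀, trivial⟩⟩
  have h1' : i₀ ∈ (g.toGame.survivors 1).1 := ⟨trivial, hi' _ _ trivial⟩
  refine ⟨2, i₀, v, Prod.ext ?_ ?_⟩
  · ext i
    constructor
    · rintro ⟨-, h⟩
      by_contra hi
      refine h ⟨i₀, h1', fun j hj => ?_⟩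
      rw [h1] at hj
      rw [Set.mem_singleton_iff.1 hj]
      exact hR i hi
    · rintro rfl
      exact ⟨h1', hi' _ _ (by rw [h1]; rfl)⟩
  · ext j
    constructor
    · rintro ⟨h, -⟩
      rwa [h1] at h
    · intro hj
      rw [Set.mem_singleton_iff.1 hj]
      exact ⟨by rw [h1]; rfl, hv' _ _ ⟨i₀, h1'⟩⟩

open Finset Classical in
theorem card_dominant_column_ge (m n : ℕ) :
    (n + 1) * n.factorial ^ (m + 1) ≤
      #{c : Fin (m + 1) → Equiv.Perm (Fin (n + 1)) | ∃ v, ∀ i, c i v = Fin.last n} := by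
  -- Inverting turns a prescribed last value `v` into top rank at column `v`. Injectivity of `F`
  -- reflects that distinct `v` give disjoint events.
  let F : Fin (n + 1) × (Fin (m + 1) → Equiv.Perm (Fin n)) →
      Fin (m + 1) → Equiv.Perm (Fin (n + 1)) := fun x i => (lastValueEquiv n (x.1, x.2 i)).symm
  have hF : Function.Injective F := by
    rintro ⟨v, e⟩ ⟨v', e'⟩ h
    have hi : ∀ i, (v, e i) = (v', e' i) := fun i =>
      (lastValueEquiv n).injective (Equiv.symm_bijective.injective (congrFun h i))
    exact Prod.ext (Prod.ext_iff.1 (hi 0)).1 (funext fun i => (Prod.ext_iff.1 (hi i)).2)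
  have := card_le_card_of_injOn (s := univ) F
    (t := {c : Fin (m + 1) → Equiv.Perm (Fin (n + 1)) | ∃ v, ∀ i, c i v = Fin.last n})
    (fun x _ => ?_) hF.injOn
  · simpa [Fintype.card_perm] using this
  · refine mem_coe.2 (mem_filter.2 ⟨mem_univ _, x.1, fun i => ?_⟩)
    simp only [F]
    rw [Equiv.symm_apply_eq, lastValueEquiv_last]

open Finset in
theorem rpow_neg_le_solvabilityProb {m n : ℕ} (hm : 1 ≤ m) (hmn : m ≤ n) :
    (n : ℝ) ^ (-((m : ℝ) - 1)) ≤ solvabilityProb m n := by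
  classical
  obtain ⟨m, rfl⟩ : ∃ k, m = k + 1 := ⟨m - 1, by omega⟩
  obtain ⟨n, rfl⟩ : ∃ k, n = k + 1 := ⟨n - 1, by omega⟩
  have hsub : ({g : OrdinalGame (m + 1) (n + 1) | ∃ v, ∀ i, g.2 i v = Fin.last n} : Finset _) ⊆
      ({g : OrdinalGame (m + 1) (n + 1) | g.toGame.DominanceSolvable} : Finset _) := by
    intro g hg
    obtain ⟨v, hv⟩ := (mem_filter.1 hg).2
    exact mem_filter.2 ⟨mem_univ _, g.dominanceSolvable_of_dominant_column hv⟩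
  have e : #{g : OrdinalGame (m + 1) (n + 1) | ∃ v, ∀ i, g.2 i v = Fin.last n} = _ :=
    card_filter_snd (α := Fin (n + 1) → Equiv.Perm (Fin (m + 1)))
      fun c : Fin (m + 1) → Equiv.Perm (Fin (n + 1)) => ∃ v, ∀ i, c i v = Fin.last n
  have hle := card_le_card hsub
  rw [e] at hle
  have h2 : Fintype.card (Fin (n + 1) → Equiv.Perm (Fin (m + 1))) *
      ((n + 1) * n.factorial ^ (m + 1)) ≤
      #{g : OrdinalGame (m + 1) (n + 1) | g.toGame.DominanceSolvable} := by
    refine (Nat.mul_le_mul_left _ ?_).trans hle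
    convert card_dominant_column_ge m n
  set N := Fintype.card (Fin (n + 1) → Equiv.Perm (Fin (m + 1))) with hN
  have htot : Fintype.card (OrdinalGame (m + 1) (n + 1)) =
      N * ((n + 1) ^ (m + 1) * n.factorial ^ (m + 1)) := by
    rw [Fintype.card_prod, ← hN, ← mul_pow, ← Nat.factorial_succ, Fintype.card_fun,
      Fintype.card_perm, Fintype.card_fin, Fintype.card_fin]
  have hNpos : (0 : ℝ) < N := by exact_mod_cast Fintype.card_pos
  have hF : (0 : ℝ) < n.factorial := by exact_mod_cast n.factorial_pos
  have hpos : (0 : ℝ) < ((n + 1 : ℕ) : ℝ) := by positivity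
  have h2' : (N : ℝ) * (((n : ℝ) + 1) * (n.factorial : ℝ) ^ (m + 1)) ≤
      #{g : OrdinalGame (m + 1) (n + 1) | g.toGame.DominanceSolvable} := by exact_mod_cast h2
  rw [solvabilityProb_eq_card_div, htot, show -(((m + 1 : ℕ) : ℝ) - 1) = 1 - ((m + 1 : ℕ) : ℝ) by
    ring, Real.rpow_sub hpos, Real.rpow_one, Real.rpow_natCast,
    div_le_div_iff₀ (by positivity) (by push_cast; positivity)]
  push_cast
  calc _ = (N : ℝ) * (((n : ℝ) + 1) * (n.factorial : ℝ) ^ (m + 1)) * ((n : ℝ) + 1) ^ (m + 1) := by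
        ring
    _ ≤ _ := by
      refine mul_le_mul_of_nonneg_right ?_ (by positivity)
      convert h2'

/-! ### Choice of parameters and asymptotics -/

/-- The union bound with `s = m / K`, when `m / K` is at least `n ^ θ`. -/
theorem solvabilityProb_le_of_rpow_le_div {m n K : ℕ} (hK : 2 ≤ K) (hKm : K ≤ m) (hmn : m ≤ n)
    {θ : ℝ} (hθ : 0 ≤ θ) (h : (n : ℝ) ^ θ ≤ m / K) :
    solvabilityProb m n ≤ 2 * (n : ℝ) ^ (-((θ * (1 - 1 / K) - 3 / K) * m)) := by
  set s := m / K with hs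
  have hKpos : (0 : ℝ) < K := by exact_mod_cast (by omega : 0 < K)
  have hs1 : 1 ≤ s := (Nat.one_le_div_iff (by omega)).2 hKm
  have hsm : s < m := Nat.div_lt_self (by omega) (by omega)
  have hsle : (s : ℝ) ≤ m / K := Nat.cast_div_le
  have hsge : (m : ℝ) / K ≤ s + 1 := by
    rw [div_le_iff₀ hKpos]
    have := Nat.lt_mul_div_succ m (show 0 < K by omega)
    have : (m : ℝ) < K * (s + 1) := by exact_mod_cast this
    linarith
  have hn1 : (1 : ℝ) ≤ n := by exact_mod_cast (by omega : 1 ≤ n)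
  have hn0 : (0 : ℝ) < n := by linarith
  refine (solvabilityProb_le_of_lt hs1 hsm hmn).trans ?_
  have hnum : (n : ℝ) ^ (3 * s) ≤ (n : ℝ) ^ (3 / K * (m : ℝ)) := by
    rw [← Real.rpow_natCast]
    apply Real.rpow_le_rpow_of_exponent_le hn1
    push_cast
    calc (3 : ℝ) * s ≤ 3 * (m / K) := by linarith
      _ = _ := by ring
  have hden : (n : ℝ) ^ (θ * (1 - 1 / K) * m) ≤ ((s : ℝ) + 1) ^ (m - s) := by
    calc (n : ℝ) ^ (θ * (1 - 1 / K) * m) ≤ (n : ℝ) ^ (θ * ((m - s : ℕ) : ℝ)) := by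
          apply Real.rpow_le_rpow_of_exponent_le hn1
          rw [mul_assoc, Nat.cast_sub hsm.le]
          refine mul_le_mul_of_nonneg_left ?_ hθ
          calc (1 - 1 / (K : ℝ)) * m = m - m / K := by ring
            _ ≤ m - s := by linarith
      _ = ((n : ℝ) ^ θ) ^ (m - s) := by rw [Real.rpow_mul hn0.le, Real.rpow_natCast]
      _ ≤ _ := pow_le_pow_left₀ (by positivity) (h.trans hsge) _
  have hdpos : 0 < (n : ℝ) ^ (θ * (1 - 1 / K) * m) := Real.rpow_pos_of_pos hn0 _
  calc _ ≤ 2 * (n : ℝ) ^ (3 / K * (m : ℝ)) / (n : ℝ) ^ (θ * (1 - 1 / K) * m) := by gcongr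
    _ = _ := by
      rw [mul_div_assoc, ← Real.rpow_sub hn0]
      congr 2
      ring

theorem sqrt_div_le_rpow {n : ℕ} (hn : 1 ≤ n) (h : (20 : ℝ) ≤ (n : ℝ) ^ (1 / 32 : ℝ)) :
    √(((Nat.sqrt n : ℝ) + 1) / (n + 1)) ≤ (n : ℝ) ^ (-(1 / 8) : ℝ) := by
  have hn1 : (1 : ℝ) ≤ n := by exact_mod_cast hn
  have hn0 : (0 : ℝ) < n := by linarith
  have h4 : (2 : ℝ) ≤ (n : ℝ) ^ (1 / 4 : ℝ) := by
    have := h.trans (Real.rpow_le_rpow_of_exponent_le hn1 (by norm_num : (1 / 32 : ℝ) ≤ 1 / 4))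
    linarith
  have hsq : (Nat.sqrt n : ℝ) ≤ (n : ℝ) ^ (1 / 2 : ℝ) := by
    rw [← Real.sqrt_eq_rpow]
    exact Real.nat_sqrt_le_real_sqrt
  have hone : (1 : ℝ) ≤ (n : ℝ) ^ (1 / 2 : ℝ) := Real.one_le_rpow hn1 (by norm_num)
  refine Real.sqrt_le_iff.2 ⟨by positivity, ?_⟩
  rw [← Real.rpow_natCast, ← Real.rpow_mul hn0.le, div_le_iff₀ (by positivity)]
  calc (Nat.sqrt n : ℝ) + 1 ≤ 2 * (n : ℝ) ^ (1 / 2 : ℝ) := by linarith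
    _ ≤ (n : ℝ) ^ (1 / 4 : ℝ) * (n : ℝ) ^ (1 / 2 : ℝ) := by gcongr
    _ = (n : ℝ) ^ (-(1 / 8) * (2 : ℕ) : ℝ) * n := by
      rw [← Real.rpow_add hn0, ← Real.rpow_add_one hn0.ne']
      norm_num
    _ ≤ _ := by gcongr; linarith

/-- Since `log n` is at most `12 * n ^ (1/12)` and `1/12 + 1/3 < 1/2`, the term `2 ^ (-√n)` is
negligible for every `m ≤ n ^ (1/3)`. -/
theorem half_pow_sqrt_le_rpow {n : ℕ} (hn : 1 ≤ n) (h : (20 : ℝ) ≤ (n : ℝ) ^ (1 / 32 : ℝ)) :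
    (1 / 2 : ℝ) ^ Nat.sqrt n ≤ (n : ℝ) ^ (-((n : ℝ) ^ (1 / 3 : ℝ) / 16)) := by
  have hn1 : (1 : ℝ) ≤ n := by exact_mod_cast hn
  have hn0 : (0 : ℝ) < n := by linarith
  have h12 : (20 : ℝ) ≤ (n : ℝ) ^ (1 / 12 : ℝ) :=
    h.trans (Real.rpow_le_rpow_of_exponent_le hn1 (by norm_num))
  have hhalf : (20 : ℝ) ≤ (n : ℝ) ^ (1 / 2 : ℝ) :=
    h.trans (Real.rpow_le_rpow_of_exponent_le hn1 (by norm_num))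
  have hsq : (n : ℝ) ^ (1 / 2 : ℝ) ≤ Nat.sqrt n + 1 := by
    rw [← Real.sqrt_eq_rpow]
    exact Real.real_sqrt_le_nat_sqrt_succ
  have hlog : Real.log n ≤ 12 * (n : ℝ) ^ (1 / 12 : ℝ) := by
    have := Real.log_le_rpow_div hn0.le (by norm_num : (0 : ℝ) < 1 / 12)
    linarith
  have hexp : Real.log n * ((n : ℝ) ^ (1 / 3 : ℝ) / 16) ≤ Real.log 2 * Nat.sqrt n := by
    have h1 : (n : ℝ) ^ (1 / 12 : ℝ) * (n : ℝ) ^ (1 / 3 : ℝ) * 20 ≤ (n : ℝ) ^ (1 / 2 : ℝ) := by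
      calc _ ≤ (n : ℝ) ^ (1 / 12 : ℝ) * (n : ℝ) ^ (1 / 3 : ℝ) * (n : ℝ) ^ (1 / 12 : ℝ) := by gcongr
        _ = _ := by rw [← Real.rpow_add hn0, ← Real.rpow_add hn0]; norm_num
    have h2 : (1 / 2 : ℝ) ≤ Real.log 2 := by linarith [Real.log_two_gt_d9]
    calc _ ≤ 12 * (n : ℝ) ^ (1 / 12 : ℝ) * ((n : ℝ) ^ (1 / 3 : ℝ) / 16) := by gcongr
      _ ≤ 1 / 2 * Nat.sqrt n := by linarith
      _ ≤ _ := by gcongr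
  rw [Real.rpow_def_of_pos hn0, one_div, inv_pow, ← Real.rpow_natCast,
    Real.rpow_def_of_pos two_pos, ← Real.exp_neg]
  apply Real.exp_le_exp.2
  linarith

theorem solvabilityProb_le_of_le_rpow {m n : ℕ} (hm : 2 ≤ m) (hn : 1 ≤ n)
    (hmn : (m : ℝ) ≤ (n : ℝ) ^ (1 / 3 : ℝ)) (h : (20 : ℝ) ≤ (n : ℝ) ^ (1 / 32 : ℝ)) :
    solvabilityProb m n ≤ (n : ℝ) ^ (-(1 / 32 * (m : ℝ))) := by
  have hn1 : (1 : ℝ) ≤ n := by exact_mod_cast hn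
  have hn0 : (0 : ℝ) < n := by linarith
  obtain ⟨p, rfl⟩ : ∃ p, m = p + 1 := ⟨m - 1, by omega⟩
  refine (solvabilityProb_succ_le (by omega) n (Nat.sqrt n)).trans ?_
  have hp : (1 : ℝ) ≤ p := by exact_mod_cast (by omega : 1 ≤ p)
  have h1 : √(((Nat.sqrt n : ℝ) + 1) / (n + 1)) ^ p ≤
      (n : ℝ) ^ (-(((p + 1 : ℕ) : ℝ) / 16)) := by
    refine (pow_le_pow_left₀ (Real.sqrt_nonneg _) (sqrt_div_le_rpow hn h) p).trans ?_
    -- `p / 8 ≥ (p + 1) / 16` because `p ≥ 1`.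
    rw [← Real.rpow_natCast, ← Real.rpow_mul hn0.le]
    apply Real.rpow_le_rpow_of_exponent_le hn1
    push_cast
    linarith
  have h2 : (1 / 2 : ℝ) ^ Nat.sqrt n ≤ (n : ℝ) ^ (-(((p + 1 : ℕ) : ℝ) / 16)) :=
    (half_pow_sqrt_le_rpow hn h).trans
      (Real.rpow_le_rpow_of_exponent_le hn1 (by linarith))
  set m := p + 1 with hm'
  -- Half of the exponent `m / 16` is spent on the polynomial prefactor.
  have h3 : (m : ℝ) ^ 2 * 2 ≤ (n : ℝ) ^ (1 / 32 * (m : ℝ)) := by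
    have a : (m : ℝ) ≤ 2 ^ m := by exact_mod_cast Nat.lt_two_pow_self.le
    have b : (2 : ℝ) ≤ 2 ^ m := by
      simpa using pow_le_pow_right₀ (one_le_two : (1 : ℝ) ≤ 2) (by omega : 1 ≤ m)
    calc (m : ℝ) ^ 2 * 2 ≤ (2 ^ m) ^ 2 * 2 ^ m := by gcongr
      _ = 8 ^ m := by rw [← pow_succ, ← pow_mul, mul_comm, pow_mul]; norm_num
      _ ≤ ((n : ℝ) ^ (1 / 32 : ℝ)) ^ m := pow_le_pow_left₀ (by norm_num) (by linarith) _
      _ = _ := by rw [Real.rpow_mul hn0.le, Real.rpow_natCast]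
  calc _ ≤ (m : ℝ) ^ 2 * ((n : ℝ) ^ (-((m : ℝ) / 16)) + (n : ℝ) ^ (-((m : ℝ) / 16))) := by gcongr
    _ = (m : ℝ) ^ 2 * 2 * (n : ℝ) ^ (-((m : ℝ) / 16)) := by ring
    _ ≤ (n : ℝ) ^ (1 / 32 * (m : ℝ)) * (n : ℝ) ^ (-((m : ℝ) / 16)) := by gcongr
    _ = _ := by
      rw [← Real.rpow_add hn0]
      congr 1
      ring

theorem rpow_quarter_le_div_twenty {m n : ℕ} (hn : 1 ≤ n)
    (hmn : (n : ℝ) ^ (1 / 3 : ℝ) ≤ m) (h : (20 : ℝ) ≤ (n : ℝ) ^ (1 / 32 : ℝ)) :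
    (n : ℝ) ^ (1 / 4 : ℝ) ≤ m / (20 : ℕ) := by
  have hn1 : (1 : ℝ) ≤ n := by exact_mod_cast hn
  have hn0 : (0 : ℝ) < n := by linarith
  have h12 : (20 : ℝ) ≤ (n : ℝ) ^ (1 / 12 : ℝ) :=
    h.trans (Real.rpow_le_rpow_of_exponent_le hn1 (by norm_num))
  rw [le_div_iff₀ (by norm_num)]
  calc _ ≤ (n : ℝ) ^ (1 / 4 : ℝ) * (n : ℝ) ^ (1 / 12 : ℝ) := by gcongr; exact_mod_cast h12
    _ = (n : ℝ) ^ (1 / 3 : ℝ) := by rw [← Real.rpow_add hn0]; norm_num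
    _ ≤ m := hmn

theorem solvabilityProb_le_two_mul_rpow {m n : ℕ} (hm : 2 ≤ m) (hmn : m ≤ n)
    (h : (20 : ℝ) ≤ (n : ℝ) ^ (1 / 32 : ℝ)) :
    solvabilityProb m n ≤ 2 * (n : ℝ) ^ (-(1 / 32 * (m : ℝ))) := by
  have hn : 1 ≤ n := by omega
  have hn1 : (1 : ℝ) ≤ n := by exact_mod_cast hn
  rcases le_total (m : ℝ) ((n : ℝ) ^ (1 / 3 : ℝ)) with hle | hle
  · have := solvabilityProb_le_of_le_rpow hm hn hle h
    have h0 : 0 ≤ (n : ℝ) ^ (-(1 / 32 * (m : ℝ))) := by positivity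
    linarith
  · have hm20 : 20 ≤ m := by
      have : (20 : ℝ) ≤ m :=
        (h.trans (Real.rpow_le_rpow_of_exponent_le hn1 (by norm_num))).trans hle
      exact_mod_cast this
    -- With `θ = 1/4` the rate is `19/80 - 12/80 = 7/80`, above `1/32`.
    refine (solvabilityProb_le_of_rpow_le_div (K := 20) (by norm_num) hm20 hmn (by norm_num)
      (rpow_quarter_le_div_twenty hn hle h)).trans ?_
    refine mul_le_mul_of_nonneg_left (Real.rpow_le_rpow_of_exponent_le hn1 ?_) (by norm_num)
    have : (0 : ℝ) ≤ m := Nat.cast_nonneg m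
    norm_num
    linarith

theorem solvabilityProb_self_le {n : ℕ} (hn : 1 ≤ n) (h : (20 : ℝ) ≤ (n : ℝ) ^ (1 / 32 : ℝ)) :
    solvabilityProb n n ≤ (n : ℝ) ^ (-(1 / 3 * (n : ℝ))) := by
  have hn1 : (1 : ℝ) ≤ n := by exact_mod_cast hn
  have hn0 : (0 : ℝ) < n := by linarith
  have h8 : (20 : ℝ) ≤ (n : ℝ) ^ (1 / 8 : ℝ) :=
    h.trans (Real.rpow_le_rpow_of_exponent_le hn1 (by norm_num))
  have hn20 : (20 : ℝ) ≤ n := by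
    simpa using h.trans (Real.rpow_le_rpow_of_exponent_le hn1 (by norm_num : (1 / 32 : ℝ) ≤ 1))
  have hn20' : 20 ≤ n := by exact_mod_cast hn20
  have hdiv : (n : ℝ) ^ (7 / 8 : ℝ) ≤ n / (10 : ℕ) := by
    rw [le_div_iff₀ (by norm_num)]
    calc _ ≤ (n : ℝ) ^ (7 / 8 : ℝ) * (n : ℝ) ^ (1 / 8 : ℝ) := by
          gcongr
          push_cast
          linarith
      _ = n := by rw [← Real.rpow_add hn0]; norm_num
  -- With `θ = 7/8` the rate is `63/80 - 24/80 = 39/80`; the surplus over `1/3` pays for `2 ≤ n`.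
  refine (solvabilityProb_le_of_rpow_le_div (K := 10) (by norm_num) (by omega) le_rfl
    (by norm_num) hdiv).trans ?_
  calc _ ≤ (n : ℝ) ^ (1 : ℝ) *
        (n : ℝ) ^ (-((7 / 8 * (1 - 1 / (10 : ℕ)) - 3 / (10 : ℕ)) * (n : ℝ)) : ℝ) := by
        gcongr
        rw [Real.rpow_one]
        linarith
    _ ≤ _ := by
        rw [← Real.rpow_add hn0]
        apply Real.rpow_le_rpow_of_exponent_le hn1
        norm_num
        linarith

theorem eventually_twenty_le_rpow : ∀ᶠ n : ℕ in atTop, (20 : ℝ) ≤ (n : ℝ) ^ (1 / 32 : ℝ) :=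
  ((tendsto_rpow_atTop (by norm_num : (0 : ℝ) < 1 / 32)).comp
    tendsto_natCast_atTop_atTop).eventually_ge_atTop 20

theorem theorem1 :
    (∃ C₁ C₂ : ℝ, 0 < C₁ ∧ 0 < C₂ ∧ ∀ m n : ℕ, 1 ≤ m → m ≤ n →
      (n : ℝ) ^ (-((m : ℝ) - 1)) ≤ solvabilityProb m n ∧
      (2 ≤ m → solvabilityProb m n ≤ C₁ * (n : ℝ) ^ (-(C₂ * (m : ℝ))))) ∧
    (∃ ε : ℕ → ℝ, Tendsto ε atTop (𝓝 0) ∧ ∀ n : ℕ, 1 ≤ n →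
      solvabilityProb n n ≤ (n : ℝ) ^ (-((1 / 3 - ε n) * (n : ℝ)))) := by
  obtain ⟨N, hN⟩ := eventually_atTop.1 eventually_twenty_le_rpow
  constructor
  · refine ⟨max 2 ((N : ℝ) ^ (1 / 32 * (N : ℝ))), 1 / 32, lt_max_of_lt_left two_pos, by norm_num,
      fun m n hm hmn => ⟨rpow_neg_le_solvabilityProb hm hmn, fun hm2 => ?_⟩⟩
    have hn1 : (1 : ℝ) ≤ n := by exact_mod_cast (by omega : 1 ≤ n)
    have hn0 : (0 : ℝ) < n := by linarith
    rcases le_total N n with hle | hle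
    · refine (solvabilityProb_le_two_mul_rpow hm2 hmn (hN n hle)).trans ?_
      exact mul_le_mul_of_nonneg_right (le_max_left _ _) (by positivity)
    · refine (solvabilityProb_le_one m n).trans ?_
      have hnN : (n : ℝ) ≤ N := by exact_mod_cast hle
      have hmN : (m : ℝ) ≤ N := by exact_mod_cast hmn.trans hle
      have key : (n : ℝ) ^ (1 / 32 * (m : ℝ)) ≤ (N : ℝ) ^ (1 / 32 * (N : ℝ)) :=
        (Real.rpow_le_rpow hn0.le hnN (by positivity)).trans
          (Real.rpow_le_rpow_of_exponent_le (hn1.trans hnN) (by linarith))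
      calc (1 : ℝ) = (n : ℝ) ^ (1 / 32 * (m : ℝ)) * (n : ℝ) ^ (-(1 / 32 * (m : ℝ))) := by
            rw [← Real.rpow_add hn0]
            simp
        _ ≤ _ := mul_le_mul_of_nonneg_right (key.trans (le_max_right _ _)) (by positivity)
  · refine ⟨fun n => if N ≤ n then 0 else 1 / 3, ?_, fun n hn => ?_⟩
    · refine tendsto_const_nhds.congr' ?_
      filter_upwards [eventually_ge_atTop N] with n hn
      rw [if_pos hn]
    · by_cases h : N ≤ n
      · simpa [if_pos h] using solvabilityProb_self_le hn (hN n h)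
      · simpa [if_neg h] using solvabilityProb_le_one n n
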